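/- Let $\Omega\subseteq\mathbb R^3$ be a bounded open set and let $j:\mathbb R^3\to[0,+\infty]$ be a Borel measurable kernel such that (J1) $j(-z)=j(z)$ for all $z\in\mathbb R^3$; (J2) $\int_{\mathbb R^3}\min\{1,|z|^2\}\,j(z)\,dz<+\infty$; (J3) $\int_{B_R}j(z)\,dz=+\infty$ for every $R>0$, where $B_R$ is the ball of radius $R$ centered at the origin. For $m\in L^2(\Omega;\mathbb R^3)$ put $$\mathcal J_\Omega(m)=\iint_{\Omega\times\Omega}j(x-y)\,|m(x)-m(y)|^2\,dx\,dy\in[0,+\infty],$$ and let $$\mathcal X^j(\Omega;\mathbb S^2)=\{m\in L^2(\Omega;\mathbb R^3):\ m\in\mathbb S^2\text{ a.e. in }\Omega,\ \mathcal J_\Omega(m)<+\infty\}.$$ Let $h_d[m]\in L^2(\mathbb R^3;\mathbb R^3)$ be the demagnetizing field of $m$, that is, the unique solution in $L^2(\mathbb R^3;\mathbb R^3)$ of $$\operatorname{div}(m\chi_\Omega+h_d[m])=0,\qquad \operatorname{curl}h_d[m]=0\qquad\text{in the sense of distributions on }\mathbb R^3,$$ where $m\chi_\Omega$ is the extension of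 $m$ by zero outside $\Omega$, and let $\mathcal W_\Omega(m)=-\int_\Omega h_d[m]\cdot m\,dx$. Let $\varphi:\mathbb S^2\to[0,+\infty)$ be Lipschitz and let $\mu\in L^1(\mathbb R^3;\mathbb R^3)$ be odd, i.e. $\mu(-z)=-\mu(z)$ for every $z\in\mathbb R^3$. For $m\in\mathcal X^j(\Omega;\mathbb S^2)$ put $$\mathcal A_\Omega(m)=\int_\Omega\varphi(m)\,dx,\qquad \mathcal D_\Omega(m)=\iint_{\Omega\times\Omega}\mu(x-y)\cdot\big(m(x)\times m(y)\big)\,dx\,dy.$$ Then the total energy $\mathcal J_\Omega+\mathcal W_\Omega+\mathcal A_\Omega+\mathcal D_\Omega$ admits a minimizer in $\mathcal X^j(\Omega;\mathbb S^2)$: there is $m_*\in\mathcal X^j(\Omega;\mathbb S^2)$ whose total energy is at most that of every $m\in\mathcal X^j(\Omega;\mathbb S^2)$. -/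

import Mathlib

open MeasureTheory Metric
open scoped ENNReal NNReal ContDiff RealInnerProductSpace

/-- Euclidean space `ℝ³`. -/
abbrev E3 : Type := EuclideanSpace ℝ (Fin 3)

/-- The space `L²(Ω; ℝ³)` with respect to Lebesgue measure on `Ω`. -/
abbrev L2Field (Ω : Set E3) : Type := Lp E3 2 (volume.restrict Ω)

/-- The cross product on `ℝ³`. -/
def cross (a b : E3) : E3 := WithLp.toLp 2 (crossProduct a.ofLp b.ofLp)

/-- Test functions: real-valued, smooth and compactly supported on `ℝ³`. -/
def IsTestFunction (η : E3 → ℝ) : Prop := ContDiff ℝ ∞ η ∧ HasCompactSupport η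

/-- `div u = 0` in the sense of distributions on `ℝ³`. -/
def IsWeaklyDivFree (u : E3 → E3) : Prop :=
  ∀ η : E3 → ℝ, IsTestFunction η → ∫ x, ⟪u x, gradient η x⟫ = 0

/-- `curl h = 0` in the sense of distributions on `ℝ³`: the distribution `curl h` acts on a
scalar test function `η` (componentwise) as `∫ h × ∇η`. -/
def IsWeaklyCurlFree (h : E3 → E3) : Prop :=
  ∀ η : E3 → ℝ, IsTestFunction η → ∫ x, cross (h x) (gradient η x) = 0

/-- `h ∈ L²(ℝ³; ℝ³)` solves the magnetostatic Maxwell system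
`div (m χ_Ω + h) = 0`, `curl h = 0` in `ℝ³`. -/
def IsDemagField (Ω : Set E3) (m : E3 → E3) (h : Lp E3 2 (volume : Measure E3)) : Prop :=
  IsWeaklyDivFree (fun x => Ω.indicator m x + h x) ∧ IsWeaklyCurlFree h

theorem IsTestFunction.fderiv_regular {η : E3 → ℝ} (hη : IsTestFunction η) (v : E3) :
    Continuous (fun x => fderiv ℝ η x v) ∧ HasCompactSupport (fun x => fderiv ℝ η x v) :=
  ⟨(hη.1.continuous_fderiv (by simp)).clm_apply continuous_const, hη.2.fderiv_apply ℝ v⟩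

theorem integral_fderiv_swap {η ζ : E3 → ℝ} (hη : IsTestFunction η) (hζ : IsTestFunction ζ)
    (v w : E3) :
    ∫ x, fderiv ℝ η x v * fderiv ℝ ζ x w = ∫ x, fderiv ℝ η x w * fderiv ℝ ζ x v := by
  have hd : ∀ u : E3, IsTestFunction (fun x => fderiv ℝ η x u) := fun u =>
    ⟨(hη.1.fderiv_right (m := ∞) (by simp)).clm_apply contDiff_const, hη.2.fderiv_apply ℝ u⟩
  have key : ∀ v w : E3, ∫ x, fderiv ℝ η x v * fderiv ℝ ζ x w =
      -∫ x, fderiv ℝ (fun y => fderiv ℝ η y v) x w * ζ x := by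
    intro v w
    have c1 := (hd v).fderiv_regular w
    have c2 := hζ.fderiv_regular w
    refine integral_mul_fderiv_eq_neg_fderiv_mul_of_integrable (f := fun x => fderiv ℝ η x v)
      ?_ ?_ ?_ ?_ ?_
    · exact (c1.1.mul hζ.1.continuous).integrable_of_hasCompactSupport c1.2.mul_right
    · exact ((hd v).1.continuous.mul c2.1).integrable_of_hasCompactSupport (hd v).2.mul_right
    · exact ((hd v).1.continuous.mul hζ.1.continuous).integrable_of_hasCompactSupport
        (hd v).2.mul_right
    · exact fun x _ => ((hd v).1.differentiable (by simp)) x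
    · exact fun x _ => (hζ.1.differentiable (by simp)) x
  rw [key, key]
  congr 2
  ext x
  congr 1
  have hdiff : DifferentiableAt ℝ (fderiv ℝ η) x :=
    ((hη.1.fderiv_right (m := ∞) (by simp)).differentiable (by simp)) x
  have hs := ((contDiff_infty.1 hη.1 2).contDiffAt (x := x)).isSymmSndFDerivAt (by
    rw [minSmoothness_of_isRCLikeNormedField]; exact le_rfl)
  rw [fderiv_clm_apply hdiff (differentiableAt_const _),
    fderiv_clm_apply hdiff (differentiableAt_const _)]
  simpa using hs w v

theorem gradient_coord (η : E3 → ℝ) (x : E3) (i : Fin 3) :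
    gradient η x i = fderiv ℝ η x (EuclideanSpace.single i 1) := by
  have h := inner_gradient_left (𝕜 := ℝ) (f := η) (x := x) (y := EuclideanSpace.single i 1)
  rw [← h, EuclideanSpace.inner_single_right]
  simp

theorem inner_cross (a b c : E3) : ⟪cross a c, b⟫ =
    c 0 * (b 1 * a 2 - b 2 * a 1) + c 1 * (b 2 * a 0 - b 0 * a 2)
      + c 2 * (b 0 * a 1 - b 1 * a 0) := by
  simp [cross, PiLp.inner_apply, Fin.sum_univ_three, cross_apply]
  ring

theorem integral_inner_cross_gradient {η ζ : E3 → ℝ} (hη : IsTestFunction η)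
    (hζ : IsTestFunction ζ) (c : E3) : ∫ x, ⟪cross (gradient ζ x) c, gradient η x⟫ = 0 := by
  have hint : ∀ v w : E3, Integrable (fun x => fderiv ℝ η x v * fderiv ℝ ζ x w) := by
    intro v w
    have c1 := hη.fderiv_regular v
    have c2 := hζ.fderiv_regular w
    exact (c1.1.mul c2.1).integrable_of_hasCompactSupport c1.2.mul_right
  have hz : ∀ v w : E3, ∫ x, (fderiv ℝ η x v * fderiv ℝ ζ x w - fderiv ℝ η x w * fderiv ℝ ζ x v)
      = 0 := by
    intro v w
    rw [integral_sub (hint _ _) (hint _ _), integral_fderiv_swap hη hζ, sub_self]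
  simp_rw [inner_cross, gradient_coord]
  have hi : ∀ (r : ℝ) (v w : E3), Integrable (fun x => r * (fderiv ℝ η x v * fderiv ℝ ζ x w
      - fderiv ℝ η x w * fderiv ℝ ζ x v)) := fun r v w =>
    ((hint v w).sub (hint w v)).const_mul r
  rw [integral_add, integral_add (hi _ _ _) (hi _ _ _)]
  rotate_left
  · exact (hi _ _ _).add (hi _ _ _)
  · exact hi _ _ _
  simp only [integral_const_mul, hz]
  simp

theorem continuous_cross {f g : E3 → E3} (hf : Continuous f) (hg : Continuous g) :
    Continuous fun x => cross (f x) (g x) := by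
  refine (PiLp.continuous_toLp 2 _).comp (continuous_pi fun i => ?_)
  fin_cases i <;> simp [cross_apply] <;> fun_prop

theorem IsTestFunction.gradient_regular {η : E3 → ℝ} (hη : IsTestFunction η) :
    Continuous (gradient η) ∧ HasCompactSupport (gradient η) := by
  constructor
  · exact (InnerProductSpace.toDual ℝ E3).symm.continuous.comp
      (hη.1.continuous_fderiv (by simp))
  · exact (hη.2.fderiv ℝ).comp_left (g := (InnerProductSpace.toDual ℝ E3).symm) (map_zero _)

theorem memLp_gradient {η : E3 → ℝ} (hη : IsTestFunction η) :
    MemLp (gradient η) 2 (volume : Measure E3) :=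
  hη.gradient_regular.1.memLp_of_hasCompactSupport hη.gradient_regular.2

theorem memLp_gradient_cross {η : E3 → ℝ} (hη : IsTestFunction η) (c : E3) :
    MemLp (fun x => cross (gradient η x) c) 2 (volume : Measure E3) :=
  (continuous_cross hη.gradient_regular.1 continuous_const).memLp_of_hasCompactSupport
    (hη.gradient_regular.2.comp_left (g := fun a => cross a c) (by simp [cross]))

theorem exists_orthogonal_split {H : Type*} [NormedAddCommGroup H] [InnerProductSpace ℝ H]
    [CompleteSpace H] (S : Submodule ℝ H) (u : H) : ∃ p ∈ Sᗮ, u - p ∈ Sᗮᗮ :=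
  ⟨_, Submodule.starProjection_apply_mem _ _, Submodule.sub_starProjection_mem_orthogonal _⟩

theorem exists_isDemagField {Ω : Set E3} (hΩ : MeasurableSet Ω) (m : L2Field Ω) :
    ∃ h : Lp E3 2 (volume : Measure E3), IsDemagField Ω m h := by
  let S : Submodule ℝ (Lp E3 2 (volume : Measure E3)) := Submodule.span ℝ
    {f | ∃ (η : E3 → ℝ) (hη : IsTestFunction η) (c : E3), f = (memLp_gradient_cross hη c).toLp _}
  have hm : MemLp (Ω.indicator m) 2 (volume : Measure E3) :=
    (memLp_indicator_iff_restrict hΩ).2 (Lp.memLp m)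
  obtain ⟨p, hp, hup⟩ : ∃ p ∈ Sᗮ, hm.toLp _ - p ∈ Sᗮᗮ :=
    exists_orthogonal_split S _
  refine ⟨-p, ?_, ?_⟩
  · intro η hη
    have h1 : (memLp_gradient hη).toLp _ ∈ Sᗮ := by
      rw [Submodule.mem_orthogonal]
      intro f hf
      induction hf using Submodule.span_induction with
      | mem f hf =>
        obtain ⟨ζ, hζ, c, rfl⟩ := hf
        rw [MeasureTheory.L2.inner_def, ← integral_inner_cross_gradient hη hζ c]
        refine integral_congr_ae ?_
        filter_upwards [(memLp_gradient_cross hζ c).coeFn_toLp, (memLp_gradient hη).coeFn_toLp]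
          with x h1 h2
        rw [h1, h2]
      | zero => simp
      | add f g _ _ hf hg => rw [inner_add_left, hf, hg, add_zero]
      | smul r f _ hf => rw [inner_smul_left, hf, mul_zero]
    have h2 := Submodule.inner_left_of_mem_orthogonal h1 hup
    rw [MeasureTheory.L2.inner_def] at h2
    rw [← h2]
    refine integral_congr_ae ?_
    filter_upwards [(memLp_gradient hη).coeFn_toLp, hm.coeFn_toLp,
      Lp.coeFn_neg p, Lp.coeFn_sub (hm.toLp _) p] with x e1 e2 e3 e4
    rw [e1, e4, e3, Pi.sub_apply, Pi.neg_apply, e2, sub_eq_add_neg]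
  · intro η hη
    have hmem : -p ∈ Sᗮ := Sᗮ.neg_mem hp
    generalize -p = h at hmem ⊢
    by_cases hint : Integrable (fun x => cross (h x) (gradient η x))
    swap
    · exact integral_undef hint
    refine ext_inner_left ℝ fun c => ?_
    rw [← integral_inner hint, inner_zero_right]
    have h3 := (Submodule.mem_orthogonal _ _).1 hmem _
      (Submodule.subset_span ⟨η, hη, c, rfl⟩)
    rw [MeasureTheory.L2.inner_def] at h3
    rw [← h3]
    refine integral_congr_ae ?_
    filter_upwards [(memLp_gradient_cross hη c).coeFn_toLp] with x e1
    rw [e1, inner_cross, real_inner_comm, cross, PiLp.inner_apply]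
    simp [Fin.sum_univ_three, cross_apply]

/-- The demagnetizing (stray) field `h_d[m] ∈ L²(ℝ³; ℝ³)`: the solution of the magnetostatic
Maxwell system (an `L²` field which is both divergence free and curl free on `ℝ³` vanishes, so
there is exactly one solution). -/
noncomputable def demagField {Ω : Set E3} (hΩ : IsOpen Ω) (m : L2Field Ω) :
    Lp E3 2 (volume : Measure E3) :=
  (exists_isDemagField hΩ.measurableSet m).choose

theorem demagField_spec {Ω : Set E3} (hΩ : IsOpen Ω) (m : L2Field Ω) :
    IsDemagField Ω m (demagField hΩ m) :=
  (exists_isDemagField hΩ.measurableSet m).choose_spec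

/-- The nonlocal exchange energy `∬_{Ω×Ω} j(x-y) |m(x)-m(y)|² dx dy ∈ [0,∞]`. -/
noncomputable def exchangeEnergy (j : E3 → ℝ≥0∞) {Ω : Set E3} (m : L2Field Ω) : ℝ≥0∞ :=
  ∫⁻ p in Ω ×ˢ Ω, j (p.1 - p.2) * ‖m p.1 - m p.2‖ₑ ^ 2

/-- The magnetostatic self-energy `-∫_Ω h_d[m] · m dx`. -/
noncomputable def magnetostaticEnergy {Ω : Set E3} (hΩ : IsOpen Ω) (m : L2Field Ω) : ℝ :=
  -∫ x in Ω, ⟪demagField hΩ m x, m x⟫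

/-- The anisotropy energy `∫_Ω φ(m) dx`; for sphere-valued `m` only the values of `φ` on the
unit sphere matter. -/
noncomputable def anisotropyEnergy (φ : E3 → ℝ) {Ω : Set E3} (m : L2Field Ω) : ℝ :=
  ∫ x in Ω, φ (m x)

/-- The nonlocal antisymmetric exchange (Dzyaloshinskii-Moriya) energy
`∬_{Ω×Ω} μ(x-y) · (m(x) × m(y)) dx dy`. -/
noncomputable def dmiEnergy (μ : E3 → E3) {Ω : Set E3} (m : L2Field Ω) : ℝ :=
  ∫ p in Ω ×ˢ Ω, ⟪μ (p.1 - p.2), cross (m p.1) (m p.2)⟫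

/-- The class `𝒳^j(Ω; 𝕊²)` of fields in `L²(Ω; ℝ³)` which are unit vectors a.e. in `Ω` and have
finite exchange energy. -/
def admissibleFields (j : E3 → ℝ≥0∞) (Ω : Set E3) : Set (L2Field Ω) :=
  {m | (∀ᵐ x ∂volume.restrict Ω, m x ∈ sphere (0 : E3) 1) ∧ exchangeEnergy j m < ⊤}

/-- The total micromagnetic energy on the class `𝒳^j(Ω; 𝕊²)`, where the exchange energy is
finite. -/
noncomputable def totalEnergy (j : E3 → ℝ≥0∞) (φ : E3 → ℝ) (μ : E3 → E3) {Ω : Set E3}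
    (hΩ : IsOpen Ω) (m : L2Field Ω) : ℝ :=
  (exchangeEnergy j m).toReal + magnetostaticEnergy hΩ m + anisotropyEnergy φ m + dmiEnergy μ m

/-- The kernel is symmetric. -/
def KernelSymmetric (j : E3 → ℝ≥0∞) : Prop := ∀ z, j (-z) = j z

/-- The Lévy-type condition `∫ min{1, |z|²} j(z) dz < ∞`. -/
def KernelLevy (j : E3 → ℝ≥0∞) : Prop := ∫⁻ z, min 1 (‖z‖ₑ ^ 2) * j z < ⊤

/-- `j` is integrable on no ball centered at the origin. -/
def KernelNonintegrable (j : E3 → ℝ≥0∞) : Prop := ∀ R > (0 : ℝ), ∫⁻ z in ball (0 : E3) R, j z = ⊤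

/-! ### Square integrable fields that are divergence free and curl free -/

open Filter Topology

/-! The proof is the direct method; its heart is strong `L²` compactness of a minimizing sequence.
Sphere-valued fields on a bounded set have a fixed `L²` norm, so a subsequence converges weakly to
some `a` with `|a| ≤ 1`, and convergence is strong once `|a| = 1` a.e. This is where
nonintegrability of `j` enters. On the sphere `|m(x) - m(y)|² = 2 - 2 m(x)·m(y)`. With `j` replaced
by the bounded kernel `min(j, N)`, the form `∬ min(j, N)(x-y) m(x)·m(y)` is weakly continuous
(`tendsto_integral_kernel_inner`), so the energy bound survives in the limit as a bound on `∬ min(j,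
N)(x-y) (2 - 2 a(x)·a(y))`. The last factor is at least `1 - |a(x)|²`. Letting `N → ∞` gives `∬
j(x-y) (1 - |a(x)|²) < ∞`, while `∫_Ω j(x-y) dy = ∞` for every `x` in the open set `Ω`; hence `|a| =
1` (`norm_eq_one_of_weak`).

Along a further subsequence converging a.e., the exchange energy is lower semicontinuous by Fatou,
and the anisotropy and antisymmetric terms converge by dominated convergence. The magnetostatic
energy is the quadratic form of an orthogonal projection, hence continuous and nonnegative. This
last identification needs uniqueness of the demagnetizing field: the components of a field with zero
divergence and curl are harmonic, and the Fourier transform shows that a harmonic `L²` function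
vanishes. -/

theorem aestronglyMeasurable_clm_apply {F : Type*} [NormedAddCommGroup F] [NormedSpace ℝ F]
    {A : E3 → E3 →L[ℝ] F} {u : E3 → E3} {ν : Measure E3} (hA : AEStronglyMeasurable A ν)
    (hu : AEStronglyMeasurable u ν) : AEStronglyMeasurable (fun x => A x (u x)) ν :=
  (isBoundedBilinearMap_apply (𝕜 := ℝ) (E := E3) (F := F)).continuous.comp_aestronglyMeasurable
    (hA.prodMk hu)

theorem inner_gradient_eq_fderiv (η : E3 → ℝ) (x v : E3) :
    ⟪v, gradient η x⟫ = fderiv ℝ η x v := by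
  rw [real_inner_comm]
  exact inner_gradient_left (𝕜 := ℝ)

/-- A weakly divergence free `L²` field annihilates the gradients of all smooth `H¹` functions. -/
theorem IsWeaklyDivFree.integral_fderiv_eq_zero {u : E3 → E3} (hu : IsWeaklyDivFree u)
    (hu2 : MemLp u 2 volume) {ψ : E3 → ℝ} (hψ : ContDiff ℝ ∞ ψ) (h0 : MemLp ψ 2 volume)
    (h1 : MemLp (fderiv ℝ ψ) 2 volume) : ∫ x, fderiv ℝ ψ x (u x) = 0 := by
  let χ : ContDiffBump (0 : E3) := ⟨1, 2, one_pos, one_lt_two⟩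
  have hχ : ContDiff ℝ ∞ χ := χ.contDiff
  have hχd : Differentiable ℝ χ := hχ.differentiable (by simp)
  have hψd : Differentiable ℝ ψ := hψ.differentiable (by simp)
  obtain ⟨C, hC⟩ := (χ.hasCompactSupport.fderiv ℝ).exists_bound_of_continuous
    (hχ.continuous_fderiv (by simp))
  have hC0 : 0 ≤ C := (norm_nonneg _).trans (hC 0)
  let c : ℕ → ℝ := fun n => ((n : ℝ) + 1)⁻¹
  have hc0 : ∀ n, 0 < c n := fun n => by positivity
  have hc1 : ∀ n, c n ≤ 1 := fun n => inv_le_one_of_one_le₀ (by simp)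
  have hclim : Tendsto c atTop (𝓝 0) := by
    simpa [c, one_div] using tendsto_one_div_add_atTop_nhds_zero_nat (𝕜 := ℝ)
  -- The product rule for the test function `χ(c n • x) ψ(x)`. The derivative falling on the cutoff
  -- carries the factor `c n → 0`, so only the term with `fderiv ℝ ψ` survives.
  let F : ℕ → E3 → ℝ := fun n x =>
    χ (c n • x) * fderiv ℝ ψ x (u x) + ψ x * (c n * fderiv ℝ χ (c n • x) (u x))
  have hF : ∀ n, ∫ x, F n x = 0 := by
    intro n
    have hs : ContDiff ℝ ∞ fun x : E3 => χ (c n • x) := hχ.comp (contDiff_id.const_smul (c n))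
    have ht : IsTestFunction fun x => χ (c n • x) * ψ x :=
      ⟨hs.mul hψ, (χ.hasCompactSupport.comp_smul (hc0 n).ne').mul_right⟩
    rw [← hu _ ht]
    refine integral_congr_ae (Eventually.of_forall fun x => ?_)
    simp only [inner_gradient_eq_fderiv]
    rw [fderiv_fun_mul (hs.differentiable (by simp) x) (hψd x), fderiv_comp_smul]
    simp [F]
  have hlim : Tendsto (fun n => ∫ x, F n x) atTop (𝓝 (∫ x, fderiv ℝ ψ x (u x))) := by
    refine tendsto_integral_of_dominated_convergence
      (fun x => ‖fderiv ℝ ψ x‖ * ‖u x‖ + C * (‖ψ x‖ * ‖u x‖)) ?_ ?_ ?_ ?_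
    · intro n
      have hcont : Continuous fun x : E3 => c n • x := continuous_const_smul (c n)
      exact ((hχ.continuous.comp hcont).aestronglyMeasurable.mul
        (aestronglyMeasurable_clm_apply h1.1 hu2.1)).add (h0.1.mul
          ((aestronglyMeasurable_clm_apply ((hχ.continuous_fderiv (by simp)).comp
            hcont).aestronglyMeasurable hu2.1).const_mul (c n)))
    · exact (h1.norm.integrable_mul hu2.norm).add ((h0.norm.integrable_mul hu2.norm).const_mul C)
    · intro n
      refine Eventually.of_forall fun x => ?_
      refine (norm_add_le _ _).trans (add_le_add ?_ ?_)
      · rw [norm_mul, Real.norm_of_nonneg χ.nonneg]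
        exact (mul_le_of_le_one_left (norm_nonneg _) χ.le_one).trans
          ((fderiv ℝ ψ x).le_opNorm _)
      · rw [norm_mul, norm_mul, Real.norm_of_nonneg (hc0 n).le]
        calc ‖ψ x‖ * (c n * ‖fderiv ℝ χ (c n • x) (u x)‖)
            ≤ ‖ψ x‖ * (1 * (C * ‖u x‖)) := by
              gcongr
              · exact hc1 n
              · exact (fderiv ℝ χ (c n • x)).le_of_opNorm_le (hC _) _
          _ = _ := by ring
    · refine Eventually.of_forall fun x => ?_
      have hcx : Tendsto (fun n => c n • x) atTop (𝓝 0) := by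
        simpa using hclim.smul_const x
      have e1 : Tendsto (fun n => χ (c n • x)) atTop (𝓝 1) := by
        have := (hχ.continuous.tendsto 0).comp hcx
        rwa [χ.one_of_mem_closedBall (mem_closedBall_self zero_le_one)] at this
      have e2 : Tendsto (fun n => fderiv ℝ χ (c n • x) (u x)) atTop (𝓝 (fderiv ℝ χ 0 (u x))) :=
        (((hχ.continuous_fderiv (by simp)).clm_apply continuous_const).tendsto 0).comp hcx
      simpa [F] using (e1.mul_const (fderiv ℝ ψ x (u x))).add ((hclim.mul e2).const_mul (ψ x))
  simp only [hF] at hlim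
  exact tendsto_nhds_unique hlim tendsto_const_nhds

open SchwartzMap LineDeriv Laplacian FourierTransform

/-- Tempered distributions are tested against complex Schwartz functions; the real and imaginary
parts of these are smooth `H¹` functions, to which `IsWeaklyDivFree.integral_fderiv_eq_zero`
applies. -/
theorem IsWeaklyDivFree.integral_schwartz_eq_zero {u : E3 → E3} (hu : IsWeaklyDivFree u)
    (hu2 : MemLp u 2 volume) (g : 𝓢(E3, ℂ)) : ∫ x, fderiv ℝ g x (u x) = 0 := by
  have key : ∀ L : ℂ →L[ℝ] ℝ, ∫ x, L (fderiv ℝ g x (u x)) = 0 := by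
    intro L
    have hd : ∀ x, fderiv ℝ (fun y => L (g y)) x = L.comp (fderiv ℝ g x) := fun x =>
      ((L.hasFDerivAt).comp x g.differentiableAt.hasFDerivAt).fderiv
    have h1 : MemLp (fderiv ℝ g) 2 (volume : Measure E3) := (fderivCLM ℝ E3 ℂ g).memLp 2 volume
    have := hu.integral_fderiv_eq_zero hu2 (ψ := fun y => L (g y))
      (L.contDiff.comp (g.smooth ⊤)) (L.comp_memLp' (g.memLp 2 volume)) (by
        simp only [funext hd]
        exact ((ContinuousLinearMap.compL ℝ E3 ℂ ℝ) L).comp_memLp' h1)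
    simpa only [hd, ContinuousLinearMap.comp_apply] using this
  have h1 : MemLp (fderiv ℝ g) 2 (volume : Measure E3) := (fderivCLM ℝ E3 ℂ g).memLp 2 volume
  have hint : Integrable (fun x => fderiv ℝ g x (u x)) :=
    (h1.norm.integrable_mul hu2.norm).mono' (aestronglyMeasurable_clm_apply h1.1 hu2.1)
      (Eventually.of_forall fun x => (fderiv ℝ g x).le_opNorm _)
  apply Complex.ext
  · rw [← Complex.reCLM_apply, ← Complex.reCLM.integral_comp_comm hint]; simpa using key Complex.reCLM
  · rw [← Complex.imCLM_apply, ← Complex.imCLM.integral_comp_comm hint]; simpa using key Complex.imCLM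

/-- On the Fourier side `|ξ|² ŵ = 0`, so `ŵ` vanishes off the origin, a null set, and Plancherel
gives `w = 0`. -/
theorem eq_zero_of_laplacian_eq_zero (w : Lp ℂ 2 (volume : Measure E3))
    (hw : Δ (w : 𝓢'(E3, ℂ)) = 0) : w = 0 := by
  rw [TemperedDistribution.laplacian_eq_fourierMultiplierCLM,
    TemperedDistribution.fourierMultiplierCLM_apply, Lp.fourier_toTemperedDistribution_eq] at hw
  have hw2 : TemperedDistribution.smulLeftCLM ℂ (fun x : E3 => ((‖x‖ ^ 2 : ℝ) : ℂ))
      ((𝓕 w : Lp ℂ 2 (volume : Measure E3)) : 𝓢'(E3, ℂ)) = 0 := by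
    have h3 := (smul_eq_zero.1 hw).resolve_left (by simp [Real.pi_ne_zero])
    have h4 := congrArg (fun T : 𝓢'(E3, ℂ) => 𝓕 T) h3
    simp only [FourierTransform.fourier_fourierInv_eq] at h4
    exact h4.trans (fourierCLM ℂ 𝓢'(E3, ℂ)).map_zero
  have hz : (𝓕 w : Lp ℂ 2 (volume : Measure E3)) = 0 := by
    set v := (𝓕 w : Lp ℂ 2 (volume : Measure E3))
    rw [Lp.eq_zero_iff_ae_eq_zero]
    have h4 : ∀ᵐ x : E3, ((‖x‖ ^ 2 : ℝ) : ℂ) • v x = 0 := by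
      apply ae_eq_zero_of_integral_contDiff_smul_eq_zero
      · have hc : Continuous fun x : E3 => ((‖x‖ ^ 2 : ℝ) : ℂ) := by fun_prop
        exact ((Lp.memLp v).locallyIntegrable one_le_two).continuous_mul hc
      · intro g hg hgc
        have hg₁ : HasCompactSupport (Complex.ofRealCLM ∘ g) := hgc.comp_left rfl
        have hg₂ : ContDiff ℝ ∞ (Complex.ofRealCLM ∘ g) := Complex.ofRealCLM.contDiff.comp hg
        have := congrArg (fun T => T (hg₁.toSchwartzMap hg₂)) hw2
        rw [TemperedDistribution.smulLeftCLM_apply_apply, Lp.toTemperedDistribution_apply] at this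
        refine Eq.trans (integral_congr_ae (Eventually.of_forall fun x => ?_)) this
        simp only
        rw [SchwartzMap.smulLeftCLM_apply_apply (by fun_prop)]
        simp
        ring
    have h5 : ∀ᵐ x : E3, x ≠ 0 := by simp [ae_iff]
    filter_upwards [h4, h5] with x h4 h5
    simpa [h5] using h4
  rw [← norm_eq_zero, ← Lp.norm_fourier_eq, hz, norm_zero]

theorem norm_cross_le (a b : E3) : ‖cross a b‖ ≤ ‖a‖ * ‖b‖ := by
  rw [cross, InnerProductGeometry.norm_ofLp_crossProduct]
  exact mul_le_of_le_one_right (by positivity) (Real.sin_le_one _)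

theorem continuous_cross_uncurry : Continuous fun p : E3 × E3 => cross p.1 p.2 := by
  refine (PiLp.continuous_toLp 2 _).comp (continuous_pi fun i => ?_)
  fin_cases i <;> simp [cross_apply] <;> fun_prop

theorem integrable_cross_gradient {u : E3 → E3} (hu : MemLp u 2 volume) {η : E3 → ℝ}
    (hη : IsTestFunction η) : Integrable fun x => cross (u x) (gradient η x) := by
  exact (hu.norm.integrable_mul (memLp_gradient hη).norm).mono'
    (continuous_cross_uncurry.comp_aestronglyMeasurable (hu.1.prodMk (memLp_gradient hη).1))
    (Eventually.of_forall fun x => norm_cross_le _ _)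

/-- The divergence of this field is, up to sign, a component of `curl u`. Rewriting the curl
condition this way lets the extension to Schwartz test functions serve both equations. -/
theorem IsWeaklyCurlFree.isWeaklyDivFree_rotate {u : E3 → E3} (hu : IsWeaklyCurlFree u)
    (hu2 : MemLp u 2 volume) (i j : Fin 3) :
    IsWeaklyDivFree fun x => u x i • EuclideanSpace.single j (1 : ℝ)
      - u x j • EuclideanSpace.single i (1 : ℝ) := by
  intro η hη
  have hint := integrable_cross_gradient hu2 hη
  have hk : ∀ k : Fin 3, ∫ x, cross (u x) (gradient η x) k = 0 := by
    intro k
    have := (EuclideanSpace.proj (𝕜 := ℝ) k).integral_comp_comm hint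
    simpa [hu η hη] using this
  have key : ∀ i j : Fin 3, ∫ x, (u x i * gradient η x j - u x j * gradient η x i) = 0 := by
    have hneg : ∀ i j : Fin 3, ∫ x, (u x i * gradient η x j - u x j * gradient η x i) = 0 →
        ∫ x, (u x j * gradient η x i - u x i * gradient η x j) = 0 := by
      intro i j h
      rw [← neg_eq_zero, ← integral_neg]
      simpa using h
    have h0 := hk 0
    have h1 := hk 1
    have h2 := hk 2
    simp only [cross, cross_apply] at h0 h1 h2
    intro i j
    fin_cases i <;> fin_cases j <;>
      first
      | simp; done
      | exact h0
      | exact h1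
      | exact h2
      | exact hneg _ _ h0
      | exact hneg _ _ h1
      | exact hneg _ _ h2
  rw [← key i j]
  refine integral_congr_ae (Eventually.of_forall fun x => ?_)
  simp [gradient_coord]

/-- The `i`-th coordinate of an `L²` field, as a complex valued `L²` function. -/
noncomputable def complexCoord (u : Lp E3 2 (volume : Measure E3)) (i : Fin 3) :
    Lp ℂ 2 (volume : Measure E3) :=
  (Complex.ofRealCLM.comp (EuclideanSpace.proj (𝕜 := ℝ) i : E3 →L[ℝ] ℝ)).compLp u

theorem complexCoord_ae (u : Lp E3 2 (volume : Measure E3)) (i : Fin 3) :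
    ∀ᵐ x, complexCoord u i x = (u x i : ℂ) :=
  (Complex.ofRealCLM.comp (EuclideanSpace.proj (𝕜 := ℝ) i : E3 →L[ℝ] ℝ)).coeFn_compLp u

theorem lineDeriv_complexCoord (u : Lp E3 2 (volume : Measure E3)) (i : Fin 3) (v : E3)
    (g : 𝓢(E3, ℂ)) :
    (∂_{v} (complexCoord u i : 𝓢'(E3, ℂ))) g = -∫ x, fderiv ℝ g x (u x i • v) := by
  rw [TemperedDistribution.lineDerivOp_apply_apply, map_neg, Lp.toTemperedDistribution_apply]
  congr 1
  refine integral_congr_ae ?_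
  filter_upwards [complexCoord_ae u i] with x hx
  rw [hx, lineDerivOp_apply_eq_fderiv]
  simp [mul_comm]

theorem integrable_fderiv_smul (u : Lp E3 2 (volume : Measure E3)) (i : Fin 3) (v : E3)
    (g : 𝓢(E3, ℂ)) : Integrable fun x => fderiv ℝ g x (u x i • v) := by
  have h1 : MemLp (fun x => fderiv ℝ g x v) 2 (volume : Measure E3) := (∂_{v} g).memLp 2 volume
  have h2 : MemLp (fun x => u x i) 2 (volume : Measure E3) :=
    (EuclideanSpace.proj (𝕜 := ℝ) i : E3 →L[ℝ] ℝ).comp_memLp' (Lp.memLp u)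
  simp only [map_smul]
  exact memLp_one_iff_integrable.1 (h1.smul h2)

theorem schwartz_lineDeriv_comm (v w : E3) (g : 𝓢(E3, ℂ)) :
    ∂_{v} (∂_{w} g) = ∂_{w} (∂_{v} g) := by
  have key : ∀ (v w x : E3), (∂_{v} (∂_{w} g)) x = fderiv ℝ (fderiv ℝ g) x v w := by
    intro v w x
    have hd : DifferentiableAt ℝ (fderiv ℝ g) x :=
      (((g.smooth ⊤).fderiv_right (m := ∞) (by simp)).differentiable (by simp)) x
    change fderiv ℝ (fun y => fderiv ℝ g y w) x v = _
    rw [fderiv_clm_apply hd (differentiableAt_const _)]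
    simp
  ext x
  rw [key, key]
  exact ((g.smooth 2).contDiffAt (x := x)).isSymmSndFDerivAt (by
    rw [minSmoothness_of_isRCLikeNormedField]; exact le_rfl) v w

/-- A square integrable field on `ℝ³` which is divergence free and curl free vanishes. -/
theorem eq_zero_of_isWeaklyDivFree_of_isWeaklyCurlFree (u : Lp E3 2 (volume : Measure E3))
    (hdiv : IsWeaklyDivFree u) (hcurl : IsWeaklyCurlFree u) : u = 0 := by
  have hu2 : MemLp u 2 (volume : Measure E3) := Lp.memLp u
  let e : Fin 3 → E3 := fun i => EuclideanSpace.single i 1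
  let T : Fin 3 → 𝓢'(E3, ℂ) := fun i => (complexCoord u i : 𝓢'(E3, ℂ))
  have hsum : ∑ j, ∂_{e j} (T j) = 0 := by
    ext g
    simp only [T, sum_apply, lineDeriv_complexCoord]
    rw [Finset.sum_neg_distrib, ← integral_finsetSum _ fun i _ => integrable_fderiv_smul u i _ g]
    refine neg_eq_zero.2 ?_
    rw [← hdiv.integral_schwartz_eq_zero hu2 g]
    refine integral_congr_ae (Eventually.of_forall fun x => ?_)
    simp only
    rw [← map_sum]
    congr 1
    ext k
    fin_cases k <;> simp [e, Fin.sum_univ_three]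
  have hrot : ∀ i j, ∂_{e j} (T i) = ∂_{e i} (T j) := by
    intro i j
    ext g
    simp only [T, lineDeriv_complexCoord]
    rw [neg_inj, ← sub_eq_zero, ← integral_sub (integrable_fderiv_smul u i _ g)
      (integrable_fderiv_smul u j _ g)]
    have hm : ∀ k (v : E3), MemLp (fun x => u x k • v) 2 (volume : Measure E3) := fun k v =>
      (((EuclideanSpace.proj (𝕜 := ℝ) k : E3 →L[ℝ] ℝ).smulRight v)).comp_memLp' hu2
    have := (hcurl.isWeaklyDivFree_rotate hu2 i j).integral_schwartz_eq_zero
      ((hm i _).sub (hm j _)) g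
    simpa only [map_sub] using this
  have hcomm : ∀ (v w : E3) (S : 𝓢'(E3, ℂ)), ∂_{v} (∂_{w} S) = ∂_{w} (∂_{v} S) := by
    intro v w S
    ext g
    simp only [TemperedDistribution.lineDerivOp_apply_apply, map_neg, schwartz_lineDeriv_comm v w]
  have hzero : ∀ i, complexCoord u i = 0 := by
    intro i
    apply eq_zero_of_laplacian_eq_zero
    rw [TemperedDistribution.laplacian_eq_sum (EuclideanSpace.basisFun (Fin 3) ℝ)]
    -- Summed over `j`, this reads `Δ uᵢ = ∂ᵢ (div u) = 0`.
    have h1 : ∀ j, ∂_{e j} (∂_{e j} (T i)) = ∂_{e i} (∂_{e j} (T j)) := fun j => by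
      rw [hrot, hcomm]
    have h2 : ∑ j, ∂_{e j} (∂_{e j} (T i)) = 0 := by
      simp only [h1]
      have h3 := congrArg (lineDerivOpCLM ℂ 𝓢'(E3, ℂ) (e i)) hsum
      rw [map_sum, map_zero] at h3
      exact h3
    simpa [e, T] using h2
  rw [Lp.eq_zero_iff_ae_eq_zero]
  have hae : ∀ i, ∀ᵐ x, u x i = 0 := by
    intro i
    have h := complexCoord_ae u i
    rw [hzero i] at h
    filter_upwards [h, Lp.coeFn_zero ℂ 2 (volume : Measure E3)] with x h1 h2
    rw [h2, Pi.zero_apply] at h1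
    exact Complex.ofReal_eq_zero.1 h1.symm
  filter_upwards [ae_all_iff.2 hae] with x hx
  ext i
  simpa using hx i

/-! ### The magnetostatic energy as the quadratic form of a projection -/

theorem memLp_indicator_field {Ω : Set E3} (hΩ : MeasurableSet Ω) (m : L2Field Ω) :
    MemLp (Ω.indicator m) 2 (volume : Measure E3) :=
  (memLp_indicator_iff_restrict hΩ).2 (Lp.memLp m)

/-- The extension by zero of a field on `Ω`. -/
noncomputable def zeroExtension {Ω : Set E3} (hΩ : MeasurableSet Ω) (m : L2Field Ω) :
    Lp E3 2 (volume : Measure E3) := (memLp_indicator_field hΩ m).toLp _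

theorem inner_zeroExtension {Ω : Set E3} (hΩ : MeasurableSet Ω) (m : L2Field Ω)
    (h : Lp E3 2 (volume : Measure E3)) :
    ⟪h, zeroExtension hΩ m⟫ = ∫ x in Ω, ⟪h x, m x⟫ := by
  rw [MeasureTheory.L2.inner_def, ← integral_indicator hΩ]
  refine integral_congr_ae ?_
  filter_upwards [(memLp_indicator_field hΩ m).coeFn_toLp] with x hx
  rw [zeroExtension, hx]
  by_cases hxm : x ∈ Ω <;> simp [hxm]

theorem norm_zeroExtension_sub {Ω : Set E3} (hΩ : MeasurableSet Ω) (m n : L2Field Ω) :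
    ‖zeroExtension hΩ m - zeroExtension hΩ n‖ = ‖m - n‖ := by
  rw [zeroExtension, zeroExtension, ← MemLp.toLp_sub, Lp.norm_toLp, Lp.norm_def,
    ← Set.indicator_sub', eLpNorm_indicator_eq_eLpNorm_restrict hΩ]
  congr 1
  exact eLpNorm_congr_ae (Lp.coeFn_sub m n).symm

theorem continuous_zeroExtension {Ω : Set E3} (hΩ : MeasurableSet Ω) :
    Continuous (zeroExtension hΩ) :=
  (Isometry.of_dist_eq fun m n => by
    rw [dist_eq_norm, dist_eq_norm, norm_zeroExtension_sub]).continuous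

/-- The closure of the span of this family of curls is the space of divergence free fields. -/
noncomputable def curlSpan : Submodule ℝ (Lp E3 2 (volume : Measure E3)) := Submodule.span ℝ
  {f | ∃ (η : E3 → ℝ) (hη : IsTestFunction η) (c : E3), f = (memLp_gradient_cross hη c).toLp _}

/-- Helmholtz decomposition: fields orthogonal to all curls are curl free, and gradients are such
fields. What remains after projecting is therefore orthogonal to gradients, that is, divergence
free. -/
theorem isDemagField_neg_starProjection {Ω : Set E3} (hΩ : MeasurableSet Ω) (m : L2Field Ω) :
    IsDemagField Ω m (-(curlSpanᗮ).starProjection (zeroExtension hΩ m)) := by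
  set p := (curlSpanᗮ).starProjection (zeroExtension hΩ m) with hpdef
  have hp : p ∈ curlSpanᗮ := Submodule.starProjection_apply_mem _ _
  have hup : zeroExtension hΩ m - p ∈ curlSpanᗮᗮ :=
    Submodule.sub_starProjection_mem_orthogonal _
  refine ⟨?_, ?_⟩
  · intro η hη
    have h1 : (memLp_gradient hη).toLp _ ∈ curlSpanᗮ := by
      rw [Submodule.mem_orthogonal]
      intro f hf
      induction hf using Submodule.span_induction with
      | mem f hf =>
        obtain ⟨ζ, hζ, c, rfl⟩ := hf
        rw [MeasureTheory.L2.inner_def, ← integral_inner_cross_gradient hη hζ c]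
        refine integral_congr_ae ?_
        filter_upwards [(memLp_gradient_cross hζ c).coeFn_toLp, (memLp_gradient hη).coeFn_toLp]
          with x h1 h2
        rw [h1, h2]
      | zero => simp
      | add f g _ _ hf hg => rw [inner_add_left, hf, hg, add_zero]
      | smul r f _ hf => rw [inner_smul_left, hf, mul_zero]
    have h2 := Submodule.inner_left_of_mem_orthogonal h1 hup
    rw [MeasureTheory.L2.inner_def] at h2
    rw [← h2]
    refine integral_congr_ae ?_
    filter_upwards [(memLp_gradient hη).coeFn_toLp, (memLp_indicator_field hΩ m).coeFn_toLp,
      Lp.coeFn_neg p, Lp.coeFn_sub (zeroExtension hΩ m) p] with x e1 e2 e3 e4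
    rw [e1, e4, e3, Pi.sub_apply, Pi.neg_apply, zeroExtension, e2, sub_eq_add_neg]
  · intro η hη
    have hmem : -p ∈ curlSpanᗮ := Submodule.neg_mem _ hp
    generalize -p = h at hmem ⊢
    by_cases hint : Integrable (fun x => cross (h x) (gradient η x))
    swap
    · exact integral_undef hint
    refine ext_inner_left ℝ fun c => ?_
    rw [← integral_inner hint, inner_zero_right]
    have h3 := (Submodule.mem_orthogonal _ _).1 hmem _
      (Submodule.subset_span ⟨η, hη, c, rfl⟩)
    rw [MeasureTheory.L2.inner_def] at h3
    rw [← h3]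
    refine integral_congr_ae ?_
    filter_upwards [(memLp_gradient_cross hη c).coeFn_toLp] with x e1
    rw [e1, inner_cross, real_inner_comm, cross, PiLp.inner_apply]
    simp [Fin.sum_univ_three, cross_apply]

theorem integrable_inner_gradient {u : E3 → E3} (hu : MemLp u 2 volume) {η : E3 → ℝ}
    (hη : IsTestFunction η) : Integrable fun x => ⟪u x, gradient η x⟫ :=
  (hu.norm.integrable_mul (memLp_gradient hη).norm).mono' (hu.1.inner (memLp_gradient hη).1)
    (Eventually.of_forall fun _ => norm_inner_le_norm _ _)

theorem cross_sub_left (a b c : E3) : cross (a - b) c = cross a c - cross b c := by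
  simp [cross]

/-- The magnetostatic Maxwell system has at most one square integrable solution. -/
theorem IsDemagField.unique {Ω : Set E3} (hΩ : MeasurableSet Ω) {m : L2Field Ω}
    {h k : Lp E3 2 (volume : Measure E3)} (hh : IsDemagField Ω m h) (hk : IsDemagField Ω m k) :
    h = k := by
  have hm := memLp_indicator_field hΩ m
  rw [← sub_eq_zero]
  apply eq_zero_of_isWeaklyDivFree_of_isWeaklyCurlFree
  · intro η hη
    have e := (integral_sub (integrable_inner_gradient (hm.add (Lp.memLp h)) hη)
      (integrable_inner_gradient (hm.add (Lp.memLp k)) hη)).trans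
        (sub_eq_zero.2 ((hh.1 η hη).trans (hk.1 η hη).symm))
    rw [← e]
    refine integral_congr_ae ?_
    filter_upwards [Lp.coeFn_sub h k] with x hx
    rw [hx, ← inner_sub_left]
    simp
  · intro η hη
    have e := (integral_sub (integrable_cross_gradient (Lp.memLp h) hη)
      (integrable_cross_gradient (Lp.memLp k) hη)).trans
        (sub_eq_zero.2 ((hh.2 η hη).trans (hk.2 η hη).symm))
    rw [← e]
    refine integral_congr_ae ?_
    filter_upwards [Lp.coeFn_sub h k] with x hx
    rw [hx, Pi.sub_apply, cross_sub_left]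

/-- `demagField` is an arbitrary choice of solution; uniqueness replaces it by the explicit
projection, which depends continuously on `m`. -/
theorem magnetostaticEnergy_eq {Ω : Set E3} (hΩ : IsOpen Ω) (m : L2Field Ω) :
    magnetostaticEnergy hΩ m = ⟪(curlSpanᗮ).starProjection (zeroExtension hΩ.measurableSet m),
      zeroExtension hΩ.measurableSet m⟫ := by
  rw [magnetostaticEnergy, ← inner_zeroExtension hΩ.measurableSet,
    IsDemagField.unique hΩ.measurableSet (demagField_spec hΩ m)
      (isDemagField_neg_starProjection hΩ.measurableSet m), inner_neg_left, neg_neg]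

theorem continuous_magnetostaticEnergy {Ω : Set E3} (hΩ : IsOpen Ω) :
    Continuous (magnetostaticEnergy hΩ) := by
  simp only [funext (magnetostaticEnergy_eq hΩ)]
  have h := continuous_zeroExtension hΩ.measurableSet
  exact ((ContinuousLinearMap.continuous _).comp h).inner h

theorem magnetostaticEnergy_nonneg {Ω : Set E3} (hΩ : IsOpen Ω) (m : L2Field Ω) :
    0 ≤ magnetostaticEnergy hΩ m := by
  rw [magnetostaticEnergy_eq]
  exact Submodule.re_inner_starProjection_nonneg (𝕜 := ℝ) curlSpanᗮ _

/-! ### Weak limits in `L²` -/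

/-- Bounded sequences in a separable Hilbert space have weakly convergent subsequences. -/
theorem exists_subseq_tendsto_inner {H : Type*} [NormedAddCommGroup H] [InnerProductSpace ℝ H]
    [CompleteSpace H] [TopologicalSpace.SeparableSpace H] (x : ℕ → H) {R : ℝ}
    (hx : ∀ n, ‖x n‖ ≤ R) : ∃ (a : H) (s : ℕ → ℕ), StrictMono s ∧
      ∀ f, Tendsto (fun n => ⟪x (s n), f⟫) atTop (𝓝 ⟪a, f⟫) := by
  obtain ⟨ℓ, -, s, hs, hlim⟩ := WeakDual.isSeqCompact_closedBall ℝ H 0 R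
    (x := fun n => StrongDual.toWeakDual (InnerProductSpace.toDual ℝ H (x n)))
    (fun n => by simpa using hx n)
  refine ⟨(InnerProductSpace.toDual ℝ H).symm (WeakDual.toStrongDual ℓ), s, hs, fun f => ?_⟩
  have h : Tendsto (fun n => ⟪x (s n), f⟫) atTop (𝓝 (ℓ f)) :=
    ((WeakDual.eval_continuous f).tendsto ℓ).comp hlim
  simpa using h

theorem tendsto_of_tendsto_inner {a : ℕ → E3} {b : E3}
    (h : ∀ c, Tendsto (fun n => ⟪a n, c⟫) atTop (𝓝 ⟪b, c⟫)) : Tendsto a atTop (𝓝 b) := by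
  have h1 : Tendsto (fun n => (a n).ofLp) atTop (𝓝 b.ofLp) := by
    refine tendsto_pi_nhds.2 fun i => ?_
    simpa [EuclideanSpace.inner_single_right] using h (EuclideanSpace.single i 1)
  exact ((PiLp.continuous_toLp 2 (fun _ : Fin 3 => ℝ)).tendsto b.ofLp).comp h1

section WeakLimits

variable {ν : Measure E3} [IsFiniteMeasure ν]

theorem tendsto_integral_smul_of_weak {m : ℕ → Lp E3 2 ν} {a : Lp E3 2 ν}
    (hw : ∀ f, Tendsto (fun n => ⟪m n, f⟫) atTop (𝓝 ⟪a, f⟫)) {g : E3 → ℝ} (hg : Measurable g)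
    {N : ℝ} (hN : ∀ x, ‖g x‖ ≤ N) :
    Tendsto (fun n => ∫ x, g x • m n x ∂ν) atTop (𝓝 (∫ x, g x • a x ∂ν)) := by
  refine tendsto_of_tendsto_inner fun c => ?_
  have hgc : MemLp (fun x => g x • c) 2 ν :=
    MemLp.of_bound (hg.aestronglyMeasurable.smul_const c) (N * ‖c‖) (Eventually.of_forall fun x => by
      rw [norm_smul]; gcongr; exact hN x)
  have key : ∀ u : Lp E3 2 ν, ⟪∫ x, g x • u x ∂ν, c⟫ = ⟪u, hgc.toLp _⟫ := by
    intro u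
    have hi : Integrable (fun x => g x • u x) ν :=
      ((Lp.memLp u).integrable one_le_two).bdd_smul N hg.aestronglyMeasurable
        (Eventually.of_forall hN)
    rw [real_inner_comm, ← integral_inner hi, MeasureTheory.L2.inner_def]
    refine integral_congr_ae ?_
    filter_upwards [hgc.coeFn_toLp] with x hx
    rw [hx, inner_smul_right, inner_smul_right, real_inner_comm]
  simp only [key]
  exact hw _

/-- Testing against `a` restricted to `A = {|a| > 1}` gives `∫_A |a|² ≤ ∫_A |a|`, although `|a|² >
|a|` on `A`; so `A` is null. -/
theorem norm_le_one_of_weak {m : ℕ → Lp E3 2 ν} {a : Lp E3 2 ν}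
    (hw : ∀ f, Tendsto (fun n => ⟪m n, f⟫) atTop (𝓝 ⟪a, f⟫))
    (hm : ∀ n, ∀ᵐ x ∂ν, ‖m n x‖ ≤ 1) : ∀ᵐ x ∂ν, ‖a x‖ ≤ 1 := by
  let A : Set E3 := {x | 1 < ‖a x‖}
  have hA : MeasurableSet A :=
    measurableSet_lt measurable_const (Lp.stronglyMeasurable a).measurable.norm
  have hf : MemLp (A.indicator a) 2 ν := (Lp.memLp a).indicator hA
  have h1 : Integrable (fun x => A.indicator (fun x => ‖a x‖) x) ν :=
    (((Lp.memLp a).integrable one_le_two).norm).indicator hA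
  have h2 : Integrable (fun x => A.indicator (fun x => ‖a x‖ ^ 2) x) ν :=
    ((Lp.memLp a).integrable_norm_pow two_ne_zero).indicator hA
  have e1 : ⟪a, hf.toLp _⟫ = ∫ x, A.indicator (fun x => ‖a x‖ ^ 2) x ∂ν := by
    rw [MeasureTheory.L2.inner_def]
    refine integral_congr_ae ?_
    filter_upwards [hf.coeFn_toLp] with x hx
    rw [hx]
    by_cases hxA : x ∈ A <;> simp [hxA]
  have e2 : ∀ n, ⟪m n, hf.toLp _⟫ ≤ ∫ x, A.indicator (fun x => ‖a x‖) x ∂ν := by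
    intro n
    rw [MeasureTheory.L2.inner_def]
    refine integral_mono_ae (L2.integrable_inner _ _) h1 ?_
    filter_upwards [hf.coeFn_toLp, hm n] with x hx hx1
    rw [hx]
    by_cases hxA : x ∈ A
    · simp only [hxA, Set.indicator_of_mem]
      exact (real_inner_le_norm _ _).trans (mul_le_of_le_one_left (norm_nonneg _) hx1)
    · simp [hxA]
  have e3 := le_of_tendsto' (hw (hf.toLp _)) e2
  rw [e1, ← sub_nonpos, ← integral_sub h2 h1] at e3
  have hnn : 0 ≤ᵐ[ν] fun x => A.indicator (fun x => ‖a x‖ ^ 2) x - A.indicator (fun x => ‖a x‖) x := by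
    refine Eventually.of_forall fun x => ?_
    by_cases hxA : x ∈ A
    · have : 1 < ‖a x‖ := hxA
      simp only [hxA, Set.indicator_of_mem, Pi.zero_apply]
      nlinarith
    · simp [hxA]
  have e4 := (integral_eq_zero_iff_of_nonneg_ae hnn (h2.sub h1)).1
    (le_antisymm e3 (integral_nonneg_of_ae hnn))
  filter_upwards [e4] with x hx
  by_contra hcon
  have hxA : x ∈ A := not_le.1 hcon
  have : 1 < ‖a x‖ := hxA
  simp only [hxA, Set.indicator_of_mem, Pi.zero_apply] at hx
  nlinarith

/-- Convolution type quadratic forms with bounded kernels are weakly continuous. -/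
theorem tendsto_integral_kernel_inner {m : ℕ → Lp E3 2 ν} {a : Lp E3 2 ν}
    (hw : ∀ f, Tendsto (fun n => ⟪m n, f⟫) atTop (𝓝 ⟪a, f⟫))
    (hm : ∀ n, ∀ᵐ x ∂ν, ‖m n x‖ ≤ 1) {k : E3 → ℝ} (hk : Measurable k) {N : ℝ}
    (hN : ∀ z, ‖k z‖ ≤ N) :
    Tendsto (fun n => ∫ p, k (p.1 - p.2) * ⟪m n p.1, m n p.2⟫ ∂(ν.prod ν)) atTop
      (𝓝 (∫ p, k (p.1 - p.2) * ⟪a p.1, a p.2⟫ ∂(ν.prod ν))) := by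
  have hN0 : 0 ≤ N := (norm_nonneg _).trans (hN 0)
  have ha := norm_le_one_of_weak hw hm
  let T : Lp E3 2 ν → E3 → E3 := fun u x => ∫ y, k (x - y) • u y ∂ν
  have hTm : ∀ u, StronglyMeasurable (T u) := fun u => by
    have hk2 : Measurable fun p : E3 × E3 => k (p.1 - p.2) := hk.comp (measurable_fst.sub measurable_snd)
    exact (hk2.stronglyMeasurable.smul
      ((Lp.stronglyMeasurable u).comp_measurable measurable_snd)).integral_prod_right
  have hTb : ∀ u : Lp E3 2 ν, (∀ᵐ x ∂ν, ‖u x‖ ≤ 1) → ∀ x, ‖T u x‖ ≤ N * ν.real Set.univ := by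
    intro u hu x
    refine norm_integral_le_of_norm_le_const ?_
    filter_upwards [hu] with y hy
    rw [norm_smul]
    exact (mul_le_of_le_one_right (norm_nonneg _) hy).trans (hN _)
  -- For fixed `x` the kernel `k(x - ·)` is itself an admissible weak test. With the uniform bound
  -- `hTb`, the operator `T` turns weak convergence into strong convergence.
  have hTp : ∀ x, Tendsto (fun n => T (m n) x) atTop (𝓝 (T a x)) := fun x =>
    tendsto_integral_smul_of_weak hw (g := fun y => k (x - y))
      (hk.comp (measurable_const.sub measurable_id)) (N := N) (fun y => hN _)
  have hfub : ∀ u : Lp E3 2 ν, (∀ᵐ x ∂ν, ‖u x‖ ≤ 1) →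
      ∫ p, k (p.1 - p.2) * ⟪u p.1, u p.2⟫ ∂(ν.prod ν) = ∫ x, ⟪u x, T u x⟫ ∂ν := by
    intro u hu
    have hui : Integrable u ν := (Lp.memLp u).integrable one_le_two
    have hmeas : StronglyMeasurable fun p : E3 × E3 => k (p.1 - p.2) * ⟪u p.1, u p.2⟫ :=
      (hk.comp (measurable_fst.sub measurable_snd)).stronglyMeasurable.mul
        (((Lp.stronglyMeasurable u).comp_measurable measurable_fst).inner
          ((Lp.stronglyMeasurable u).comp_measurable measurable_snd))
    rw [integral_prod]
    · refine integral_congr_ae (Eventually.of_forall fun x => ?_)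
      have hi : Integrable (fun y => k (x - y) • u y) ν :=
        hui.bdd_smul N (hk.comp (measurable_const.sub measurable_id)).aestronglyMeasurable
          (Eventually.of_forall fun y => hN _)
      simp only [T]
      rw [← integral_inner hi]
      simp [inner_smul_right]
    · refine Integrable.of_bound hmeas.aestronglyMeasurable N ?_
      filter_upwards [Measure.quasiMeasurePreserving_fst.ae hu,
        Measure.quasiMeasurePreserving_snd.ae hu] with p h1 h2
      rw [norm_mul]
      refine (mul_le_of_le_one_right (norm_nonneg _) ?_).trans (hN _)
      exact (norm_inner_le_norm _ _).trans (mul_le_one₀ h1 (norm_nonneg _) h2)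
  simp only [fun n => hfub _ (hm n), hfub a ha]
  have hTL : ∀ u : Lp E3 2 ν, (∀ᵐ x ∂ν, ‖u x‖ ≤ 1) → MemLp (T u) 2 ν := fun u hu =>
    MemLp.of_bound (hTm u).aestronglyMeasurable _ (Eventually.of_forall (hTb u hu))
  have hinner : ∀ u v : Lp E3 2 ν, (hv : ∀ᵐ x ∂ν, ‖v x‖ ≤ 1) →
      ∫ x, ⟪u x, T v x⟫ ∂ν = ⟪u, (hTL v hv).toLp _⟫ := by
    intro u v hv
    rw [MeasureTheory.L2.inner_def]
    refine integral_congr_ae ?_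
    filter_upwards [(hTL v hv).coeFn_toLp] with x hx
    rw [hx]
  have hint : ∀ u v : Lp E3 2 ν, (hv : ∀ᵐ x ∂ν, ‖v x‖ ≤ 1) →
      Integrable (fun x => ⟪u x, T v x⟫) ν := by
    intro u v hv
    refine (L2.integrable_inner u ((hTL v hv).toLp _)).congr ?_
    filter_upwards [(hTL v hv).coeFn_toLp] with x hx
    rw [hx]
  have hdiff : Tendsto (fun n => ∫ x, ‖T (m n) x - T a x‖ ∂ν) atTop (𝓝 0) := by
    have := tendsto_integral_of_dominated_convergence (μ := ν)
      (F := fun n x => ‖T (m n) x - T a x‖) (f := fun _ => (0 : ℝ))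
      (fun _ => N * ν.real Set.univ + N * ν.real Set.univ)
      (fun n => ((hTm _).sub (hTm _)).norm.aestronglyMeasurable) (integrable_const _)
      (fun n => Eventually.of_forall fun x => by
        rw [norm_norm]
        exact (norm_sub_le _ _).trans (add_le_add (hTb _ (hm n) x) (hTb _ ha x)))
      (Eventually.of_forall fun x => by
        simpa using ((hTp x).sub_const (T a x)).norm)
    simpa using this
  have hmain : Tendsto (fun n => ∫ x, ⟪m n x, T a x⟫ ∂ν) atTop (𝓝 (∫ x, ⟪a x, T a x⟫ ∂ν)) := by
    simp only [hinner _ a ha]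
    exact hw _
  have hrem : Tendsto (fun n => ∫ x, ⟪m n x, T (m n) x⟫ ∂ν - ∫ x, ⟪m n x, T a x⟫ ∂ν) atTop (𝓝 0) := by
    refine squeeze_zero_norm (fun n => ?_) hdiff
    rw [← integral_sub (hint _ _ (hm n)) (hint _ _ ha)]
    refine norm_integral_le_of_norm_le (((hTL _ (hm n)).sub (hTL _ ha)).integrable one_le_two).norm ?_
    filter_upwards [hm n] with x hx
    rw [← inner_sub_right]
    exact (norm_inner_le_norm _ _).trans (mul_le_of_le_one_left (norm_nonneg _) hx)
  simpa using hrem.add hmain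

end WeakLimits

/-! ### Strong compactness from the nonintegrable kernel -/

theorem exchangeEnergy_eq_prod (j : E3 → ℝ≥0∞) {Ω : Set E3} (m : L2Field Ω) :
    exchangeEnergy j m = ∫⁻ p, j (p.1 - p.2) * ‖m p.1 - m p.2‖ₑ ^ 2
      ∂((volume.restrict Ω).prod (volume.restrict Ω)) := by
  rw [exchangeEnergy, Measure.prod_restrict, Measure.volume_eq_prod]

theorem tendsto_min_natCast (a : ℝ≥0∞) : Tendsto (fun N : ℕ => min a (N : ℝ≥0∞)) atTop (𝓝 a) := by
  simpa using tendsto_const_nhds.min ENNReal.tendsto_nat_nhds_top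

/-- For a nonintegrable kernel, weak limits of sphere-valued fields with bounded exchange energy
are again sphere-valued. -/
theorem norm_eq_one_of_weak {Ω : Set E3} (hΩ : IsOpen Ω)
    [IsFiniteMeasure (volume.restrict Ω : Measure E3)] {j : E3 → ℝ≥0∞} (hj : Measurable j)
    (hJ3 : KernelNonintegrable j) {m : ℕ → L2Field Ω} {a : L2Field Ω}
    (hw : ∀ f, Tendsto (fun n => ⟪m n, f⟫) atTop (𝓝 ⟪a, f⟫))
    (hm : ∀ n, ∀ᵐ x ∂volume.restrict Ω, ‖m n x‖ = 1) {C : ℝ}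
    (hC : ∀ n, exchangeEnergy j (m n) ≤ ENNReal.ofReal C) :
    ∀ᵐ x ∂volume.restrict Ω, ‖a x‖ = 1 := by
  set ν : Measure E3 := volume.restrict Ω with hν
  have hm1 : ∀ n, ∀ᵐ x ∂ν, ‖m n x‖ ≤ 1 := fun n => (hm n).mono fun x hx => hx.le
  have ha := norm_le_one_of_weak hw hm1
  have hsub : Measurable fun p : E3 × E3 => p.1 - p.2 := measurable_fst.sub measurable_snd
  have haM : Measurable fun x => ENNReal.ofReal (1 - ‖a x‖ ^ 2) :=
    (measurable_const.sub ((Lp.stronglyMeasurable a).measurable.norm.pow_const 2)).ennreal_ofReal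
  have htrunc : ∀ N : ℕ, ∫⁻ p, min (j (p.1 - p.2)) N * ENNReal.ofReal (1 - ‖a p.1‖ ^ 2) ∂(ν.prod ν)
      ≤ ENNReal.ofReal (max C 0) := by
    intro N
    let k : E3 → ℝ := fun z => (min (j z) N).toReal
    have hk : Measurable k := (hj.min measurable_const).ennreal_toReal
    have hk0 : ∀ z, 0 ≤ k z := fun z => ENNReal.toReal_nonneg
    have hkN : ∀ z, ‖k z‖ ≤ N := fun z => by
      rw [Real.norm_of_nonneg (hk0 z)]
      exact ENNReal.toReal_le_of_le_ofReal (by positivity) (by simp)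
    have hkof : ∀ z, ENNReal.ofReal (k z) = min (j z) N := fun z =>
      ENNReal.ofReal_toReal (ne_top_of_le_ne_top (ENNReal.natCast_ne_top N) (min_le_right _ _))
    have hkint : Integrable (fun p : E3 × E3 => k (p.1 - p.2)) (ν.prod ν) :=
      Integrable.of_bound (hk.comp hsub).aestronglyMeasurable N (Eventually.of_forall fun p => hkN _)
    have hint : ∀ u : L2Field Ω, (∀ᵐ x ∂ν, ‖u x‖ ≤ 1) →
        Integrable (fun p : E3 × E3 => k (p.1 - p.2) * ⟪u p.1, u p.2⟫) (ν.prod ν) := by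
      intro u hu
      refine Integrable.of_bound ((hk.comp hsub).stronglyMeasurable.mul
        (((Lp.stronglyMeasurable u).comp_measurable measurable_fst).inner
          ((Lp.stronglyMeasurable u).comp_measurable measurable_snd))).aestronglyMeasurable N ?_
      filter_upwards [Measure.quasiMeasurePreserving_fst.ae hu,
        Measure.quasiMeasurePreserving_snd.ae hu] with p h1 h2
      rw [norm_mul]
      refine (mul_le_of_le_one_right (norm_nonneg _) ?_).trans (hkN _)
      exact (norm_inner_le_norm _ _).trans (mul_le_one₀ h1 (norm_nonneg _) h2)
    -- On sphere-valued fields `Q` is the exchange energy with truncated kernel. In this polarized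
    -- form it also passes to the weak limit, not yet known to be sphere-valued.
    let Q : L2Field Ω → ℝ := fun u => 2 * ∫ p, k (p.1 - p.2) ∂(ν.prod ν)
      - 2 * ∫ p, k (p.1 - p.2) * ⟪u p.1, u p.2⟫ ∂(ν.prod ν)
    have hQ : ∀ u : L2Field Ω, (∀ᵐ x ∂ν, ‖u x‖ ≤ 1) →
        ENNReal.ofReal (Q u) = ∫⁻ p, ENNReal.ofReal (k (p.1 - p.2) * (2 - 2 * ⟪u p.1, u p.2⟫))
          ∂(ν.prod ν) := by
      intro u hu
      have e : Q u = ∫ p, k (p.1 - p.2) * (2 - 2 * ⟪u p.1, u p.2⟫) ∂(ν.prod ν) := by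
        simp only [Q]
        rw [← integral_const_mul, ← integral_const_mul,
          ← integral_sub (hkint.const_mul 2) ((hint u hu).const_mul 2)]
        exact integral_congr_ae (Eventually.of_forall fun p => by ring)
      rw [e, ofReal_integral_eq_lintegral_ofReal]
      · exact (((hkint.const_mul 2).sub ((hint u hu).const_mul 2))).congr
          (Eventually.of_forall fun p => by simp only [Pi.sub_apply]; ring)
      · filter_upwards [Measure.quasiMeasurePreserving_fst.ae hu,
          Measure.quasiMeasurePreserving_snd.ae hu] with p h1 h2
        have := (real_inner_le_norm (u p.1) (u p.2)).trans (mul_le_one₀ h1 (norm_nonneg _) h2)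
        exact mul_nonneg (hk0 _) (by linarith)
    have hQm : ∀ n, Q (m n) ≤ max C 0 := by
      intro n
      rw [← ENNReal.ofReal_le_ofReal_iff (le_max_right _ _), hQ _ (hm1 n)]
      refine le_trans ?_ ((hC n).trans (ENNReal.ofReal_le_ofReal (le_max_left _ _)))
      rw [exchangeEnergy_eq_prod]
      refine lintegral_mono_ae ?_
      filter_upwards [Measure.quasiMeasurePreserving_fst.ae (hm n),
        Measure.quasiMeasurePreserving_snd.ae (hm n)] with p h1 h2
      have e : 2 - 2 * ⟪m n p.1, m n p.2⟫ = ‖m n p.1 - m n p.2‖ ^ 2 := by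
        rw [norm_sub_sq_real, h1, h2]; ring
      rw [e, ENNReal.ofReal_mul (hk0 _), hkof, ENNReal.ofReal_pow (norm_nonneg _), ofReal_norm]
      gcongr
      exact min_le_left _ _
    have hQa : Q a ≤ max C 0 := by
      refine le_of_tendsto' (f := fun n => Q (m n)) (x := atTop) ?_ hQm
      exact ((tendsto_integral_kernel_inner hw hm1 hk hkN).const_mul 2).const_sub _
    refine le_trans ?_ (ENNReal.ofReal_le_ofReal hQa)
    rw [hQ a ha]
    refine lintegral_mono_ae ?_
    filter_upwards [Measure.quasiMeasurePreserving_fst.ae ha,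
      Measure.quasiMeasurePreserving_snd.ae ha] with p h1 h2
    rw [← hkof, ← ENNReal.ofReal_mul (hk0 _)]
    refine ENNReal.ofReal_le_ofReal (mul_le_mul_of_nonneg_left ?_ (hk0 _))
    -- `2 - 2 a(x)·a(y) = (1 - |a(x)|²) + (1 - |a(y)|²) + |a(x) - a(y)|²`, and the last two terms
    -- are nonnegative.
    have h3 := norm_sub_sq_real (a p.1) (a p.2)
    have h4 : ‖a p.2‖ ^ 2 ≤ 1 := pow_le_one₀ (norm_nonneg _) h2
    nlinarith [sq_nonneg ‖a p.1 - a p.2‖]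
  have hfull : ∫⁻ p, j (p.1 - p.2) * ENNReal.ofReal (1 - ‖a p.1‖ ^ 2) ∂(ν.prod ν)
      ≤ ENNReal.ofReal (max C 0) := by
    refine le_of_tendsto' (lintegral_tendsto_of_tendsto_of_monotone (f := fun (N : ℕ) (p : E3 × E3) =>
      min (j (p.1 - p.2)) N * ENNReal.ofReal (1 - ‖a p.1‖ ^ 2)) ?_ ?_ ?_) htrunc
    · exact fun N => (((hj.comp hsub).min measurable_const).mul
        (haM.comp measurable_fst)).aemeasurable
    · refine Eventually.of_forall fun p N M hNM => ?_
      have : (N : ℝ≥0∞) ≤ M := by exact_mod_cast hNM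
      simp only
      gcongr
    · exact Eventually.of_forall fun p => ENNReal.Tendsto.mul_const (tendsto_min_natCast _)
        (Or.inr ENNReal.ofReal_ne_top)
  have hprod : Measurable fun p : E3 × E3 => j (p.1 - p.2) * ENNReal.ofReal (1 - ‖a p.1‖ ^ 2) :=
    (hj.comp hsub).mul (haM.comp measurable_fst)
  rw [lintegral_prod _ hprod.aemeasurable] at hfull
  -- `Ω` contains a ball around `x`, which `y ↦ x - y` maps to a ball centered at the origin.
  have hinf : ∀ x ∈ Ω, ∫⁻ y, j (x - y) ∂ν = ⊤ := by
    intro x hx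
    obtain ⟨R, hR, hRΩ⟩ := Metric.isOpen_iff.1 hΩ x hx
    rw [eq_top_iff, ← hJ3 R hR, ← lintegral_indicator measurableSet_ball,
      ← lintegral_sub_left_eq_self _ x, hν, ← lintegral_indicator hΩ.measurableSet]
    refine lintegral_mono fun y => ?_
    by_cases hy : x - y ∈ ball (0 : E3) R
    · have hyΩ : y ∈ Ω := hRΩ (by
        rw [mem_ball_zero_iff] at hy
        rwa [mem_ball_comm, mem_ball_iff_norm])
      simp [hy, hyΩ]
    · simp [hy]
  have hlt := ae_lt_top' (μ := ν) (f := fun x => ∫⁻ y, j (x - y) * ENNReal.ofReal (1 - ‖a x‖ ^ 2) ∂ν)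
    (Measurable.lintegral_prod_right' hprod).aemeasurable
    (ne_top_of_le_ne_top ENNReal.ofReal_ne_top hfull)
  have hmem : ∀ᵐ x ∂ν, x ∈ Ω := ae_restrict_mem hΩ.measurableSet
  filter_upwards [hlt, hmem, ha] with x h1 h2 h3
  rw [lintegral_mul_const' _ _ ENNReal.ofReal_ne_top, hinf x h2] at h1
  have h4 : ENNReal.ofReal (1 - ‖a x‖ ^ 2) = 0 := by
    by_contra hne
    rw [ENNReal.top_mul hne] at h1
    exact lt_irrefl _ h1
  rw [ENNReal.ofReal_eq_zero] at h4
  nlinarith [norm_nonneg (a x)]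

theorem norm_sq_of_norm_eq_one {ν : Measure E3} (u : Lp E3 2 ν)
    (hu : ∀ᵐ x ∂ν, ‖u x‖ = 1) : ‖u‖ ^ 2 = ν.real Set.univ := by
  rw [← real_inner_self_eq_norm_sq, MeasureTheory.L2.inner_def]
  calc ∫ x, ⟪u x, u x⟫ ∂ν = ∫ _, (1 : ℝ) ∂ν := by
        refine integral_congr_ae ?_
        filter_upwards [hu] with x hx
        rw [real_inner_self_eq_norm_sq, hx, one_pow]
    _ = _ := by simp

/-- Compactness: sphere-valued fields with bounded exchange energy are precompact in `L²`. -/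
theorem exists_subseq_tendsto_of_exchangeEnergy_le {Ω : Set E3} (hΩ : IsOpen Ω)
    [IsFiniteMeasure (volume.restrict Ω : Measure E3)] {j : E3 → ℝ≥0∞} (hj : Measurable j)
    (hJ3 : KernelNonintegrable j) {m : ℕ → L2Field Ω}
    (hm : ∀ n, ∀ᵐ x ∂volume.restrict Ω, ‖m n x‖ = 1) {C : ℝ}
    (hC : ∀ n, exchangeEnergy j (m n) ≤ ENNReal.ofReal C) :
    ∃ (a : L2Field Ω) (s : ℕ → ℕ), StrictMono s ∧ (∀ᵐ x ∂volume.restrict Ω, ‖a x‖ = 1) ∧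
      Tendsto (fun n => m (s n)) atTop (𝓝 a) := by
  set V := (volume.restrict Ω : Measure E3).real Set.univ
  have hsq := fun n => norm_sq_of_norm_eq_one (m n) (hm n)
  have : Fact ((2 : ℝ≥0∞) ≠ ⊤) := ⟨ENNReal.ofNat_ne_top⟩
  obtain ⟨a, s, hs, hw⟩ := exists_subseq_tendsto_inner m (R := Real.sqrt V) fun n =>
    Real.le_sqrt_of_sq_le (hsq n).le
  have ha := norm_eq_one_of_weak hΩ hj hJ3 hw (fun n => hm (s n)) fun n => hC (s n)
  refine ⟨a, s, hs, ha, ?_⟩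
  rw [tendsto_iff_norm_sub_tendsto_zero]
  have h1 : Tendsto (fun n => ‖m (s n) - a‖ ^ 2) atTop (𝓝 0) := by
    -- Both norms squared equal `V`, so weak convergence tested against `a` alone gives strong
    -- convergence.
    have h2 : ∀ n, ‖m (s n) - a‖ ^ 2 = 2 * V - 2 * ⟪m (s n), a⟫ := fun n => by
      rw [norm_sub_sq_real, hsq, norm_sq_of_norm_eq_one a ha]; ring
    simp only [h2]
    have h3 := ((hw a).const_mul 2).const_sub (2 * V)
    rwa [real_inner_self_eq_norm_sq, norm_sq_of_norm_eq_one a ha, sub_self] at h3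
  simpa using h1.sqrt

/-! ### Semicontinuity and continuity of the energy terms -/

theorem exists_subseq_ae_tendsto {ν : Measure E3} {m : ℕ → Lp E3 2 ν} {a : Lp E3 2 ν}
    (h : Tendsto m atTop (𝓝 a)) : ∃ s : ℕ → ℕ, StrictMono s ∧
      ∀ᵐ x ∂ν, Tendsto (fun n => m (s n) x) atTop (𝓝 (a x)) :=
  (tendstoInMeasure_of_tendsto_Lp h).exists_seq_tendsto_ae

section Energies

variable {Ω : Set E3}

theorem exchangeEnergy_le_of_tendsto {j : E3 → ℝ≥0∞} (hj : Measurable j) {m : ℕ → L2Field Ω}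
    {a : L2Field Ω} (hlim : ∀ᵐ x ∂volume.restrict Ω, Tendsto (fun n => m n x) atTop (𝓝 (a x)))
    {c : ℕ → ℝ≥0∞} {L : ℝ≥0∞} (hc : Tendsto c atTop (𝓝 L))
    (hle : ∀ n, exchangeEnergy j (m n) ≤ c n) : exchangeEnergy j a ≤ L := by
  rw [← hc.liminf_eq]
  refine le_trans ?_ (liminf_le_liminf (Eventually.of_forall hle))
  simp only [exchangeEnergy_eq_prod]
  refine le_trans (lintegral_mono_ae ?_) (lintegral_liminf_le fun n => ?_)
  · filter_upwards [Measure.quasiMeasurePreserving_fst.ae hlim,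
      Measure.quasiMeasurePreserving_snd.ae hlim] with p h1 h2
    -- Multiplication by `j`, possibly infinite, is discontinuous at `0`; there the lower bound is
    -- trivial.
    by_cases h0 : ‖a p.1 - a p.2‖ₑ ^ 2 = 0
    · simp [h0]
    · have h3 := ENNReal.Tendsto.const_mul (a := j (p.1 - p.2))
        (ENNReal.Tendsto.pow (n := 2) (h1.sub h2).enorm) (Or.inl h0)
      exact h3.liminf_eq.ge
  · have hs := (Lp.stronglyMeasurable (m n)).measurable
    exact (hj.comp (measurable_fst.sub measurable_snd)).mul
      (((hs.comp measurable_fst).sub (hs.comp measurable_snd)).enorm.pow_const 2)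

/-- `φ` is controlled only on the sphere, so it is replaced by a Lipschitz extension to the whole
space before dominated convergence is applied. -/
theorem tendsto_anisotropyEnergy [IsFiniteMeasure (volume.restrict Ω : Measure E3)] {φ : E3 → ℝ}
    {C : ℝ≥0} (hφ : LipschitzOnWith C φ (sphere (0 : E3) 1)) {m : ℕ → L2Field Ω} {a : L2Field Ω}
    (hlim : ∀ᵐ x ∂volume.restrict Ω, Tendsto (fun n => m n x) atTop (𝓝 (a x)))
    (hm : ∀ n, ∀ᵐ x ∂volume.restrict Ω, m n x ∈ sphere (0 : E3) 1)
    (ha : ∀ᵐ x ∂volume.restrict Ω, a x ∈ sphere (0 : E3) 1) :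
    Tendsto (fun n => anisotropyEnergy φ (m n)) atTop (𝓝 (anisotropyEnergy φ a)) := by
  obtain ⟨g, hg, hgφ⟩ := hφ.extend_real
  have key : ∀ u : L2Field Ω, (∀ᵐ x ∂volume.restrict Ω, u x ∈ sphere (0 : E3) 1) →
      anisotropyEnergy φ u = ∫ x in Ω, g (u x) := fun u hu =>
    integral_congr_ae (hu.mono fun x hx => hgφ hx)
  simp only [fun n => key _ (hm n), key a ha]
  obtain ⟨B, hB⟩ := (isCompact_sphere (0 : E3) 1).exists_bound_of_continuousOn
    hg.continuous.continuousOn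
  refine tendsto_integral_of_dominated_convergence (fun _ => B)
    (fun n => hg.continuous.comp_aestronglyMeasurable (Lp.aestronglyMeasurable _))
    (integrable_const _) (fun n => (hm n).mono fun x hx => hB _ hx) ?_
  filter_upwards [hlim] with x hx
  exact (hg.continuous.tendsto _).comp hx

theorem integrable_kernel_sub [IsFiniteMeasure (volume.restrict Ω : Measure E3)]
    {μ : E3 → E3} (hμ : Integrable μ volume) :
    Integrable (fun p : E3 × E3 => μ (p.1 - p.2))
      ((volume.restrict Ω).prod (volume.restrict Ω)) := by
  have h1 : Integrable (fun _ : E3 => (1 : ℝ)) (volume.restrict Ω) := integrable_const _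
  have h2 := h1.convolution_integrand (ContinuousLinearMap.lsmul ℝ ℝ : ℝ →L[ℝ] E3 →L[ℝ] E3) hμ
  simpa using h2.mono_measure (Measure.prod_mono Measure.restrict_le_self le_rfl)

theorem dmiEnergy_eq_prod (μ : E3 → E3) (m : L2Field Ω) :
    dmiEnergy μ m = ∫ p, ⟪μ (p.1 - p.2), cross (m p.1) (m p.2)⟫
      ∂((volume.restrict Ω).prod (volume.restrict Ω)) := by
  rw [dmiEnergy, Measure.prod_restrict, Measure.volume_eq_prod]

theorem norm_dmi_integrand_le {μ : E3 → E3} {m : L2Field Ω}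
    [IsFiniteMeasure (volume.restrict Ω : Measure E3)]
    (hm : ∀ᵐ x ∂volume.restrict Ω, m x ∈ sphere (0 : E3) 1) :
    ∀ᵐ p ∂((volume.restrict Ω).prod (volume.restrict Ω)),
      ‖⟪μ (p.1 - p.2), cross (m p.1) (m p.2)⟫‖ ≤ ‖μ (p.1 - p.2)‖ := by
  filter_upwards [Measure.quasiMeasurePreserving_fst.ae hm,
    Measure.quasiMeasurePreserving_snd.ae hm] with p h1 h2
  rw [mem_sphere_zero_iff_norm] at h1 h2
  refine (norm_inner_le_norm _ _).trans (mul_le_of_le_one_right (norm_nonneg _) ?_)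
  exact (norm_cross_le _ _).trans (by rw [h1, h2, one_mul])

theorem neg_le_dmiEnergy [IsFiniteMeasure (volume.restrict Ω : Measure E3)] {μ : E3 → E3}
    (hμ : Integrable μ volume) {m : L2Field Ω}
    (hm : ∀ᵐ x ∂volume.restrict Ω, m x ∈ sphere (0 : E3) 1) :
    -(∫ p, ‖μ (p.1 - p.2)‖ ∂((volume.restrict Ω).prod (volume.restrict Ω))) ≤ dmiEnergy μ m := by
  rw [dmiEnergy_eq_prod]
  exact (abs_le.1 (norm_integral_le_of_norm_le (integrable_kernel_sub hμ).norm
    (norm_dmi_integrand_le hm))).1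

theorem tendsto_dmiEnergy [IsFiniteMeasure (volume.restrict Ω : Measure E3)] {μ : E3 → E3}
    (hμ : Integrable μ volume) {m : ℕ → L2Field Ω} {a : L2Field Ω}
    (hlim : ∀ᵐ x ∂volume.restrict Ω, Tendsto (fun n => m n x) atTop (𝓝 (a x)))
    (hm : ∀ n, ∀ᵐ x ∂volume.restrict Ω, m n x ∈ sphere (0 : E3) 1) :
    Tendsto (fun n => dmiEnergy μ (m n)) atTop (𝓝 (dmiEnergy μ a)) := by
  simp only [dmiEnergy_eq_prod]
  refine tendsto_integral_of_dominated_convergence (fun p => ‖μ (p.1 - p.2)‖) (fun n => ?_)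
    (integrable_kernel_sub hμ).norm (fun n => norm_dmi_integrand_le (hm n)) ?_
  · have hs := Lp.stronglyMeasurable (m n)
    exact (integrable_kernel_sub hμ).1.inner (continuous_cross_uncurry.comp_stronglyMeasurable
      ((hs.comp_measurable measurable_fst).prodMk
        (hs.comp_measurable measurable_snd))).aestronglyMeasurable
  · filter_upwards [Measure.quasiMeasurePreserving_fst.ae hlim,
      Measure.quasiMeasurePreserving_snd.ae hlim] with p h1 h2
    have h3 := (continuous_cross_uncurry.tendsto (a p.1, a p.2)).comp (h1.prodMk_nhds h2)
    simp only [Function.comp_def] at h3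
    exact (tendsto_const_nhds (x := μ (p.1 - p.2))).inner h3

end Energies

/-! ### The direct method -/

theorem mainTheorem7
    (Ω : Set E3) (hΩ : IsOpen Ω) (hΩb : Bornology.IsBounded Ω)
    (j : E3 → ℝ≥0∞) (hj : Measurable j)
    (hJ1 : KernelSymmetric j) (hJ2 : KernelLevy j) (hJ3 : KernelNonintegrable j)
    (φ : E3 → ℝ) (hφ_nonneg : ∀ p ∈ sphere (0 : E3) 1, 0 ≤ φ p)
    (C : ℝ≥0) (hφ_lip : LipschitzOnWith C φ (sphere (0 : E3) 1))
    (μ : E3 → E3) (hμ_int : Integrable μ volume) (hμ_odd : ∀ z, μ (-z) = -μ z) :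
    ∃ m ∈ admissibleFields j Ω, ∀ u ∈ admissibleFields j Ω,
      totalEnergy j φ μ hΩ m ≤ totalEnergy j φ μ hΩ u := by
  have : IsFiniteMeasure (volume.restrict Ω : Measure E3) :=
    ⟨by simpa using hΩb.measure_lt_top⟩
  set D := ∫ p, ‖μ (p.1 - p.2)‖ ∂((volume.restrict Ω).prod (volume.restrict Ω))
  -- Only the antisymmetric term can be negative, and it is at least `-D`; so bounded total energy
  -- bounds the exchange energy.
  have hbelow : ∀ u ∈ admissibleFields j Ω,
      (exchangeEnergy j u).toReal - D ≤ totalEnergy j φ μ hΩ u := by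
    intro u hu
    have h1 := magnetostaticEnergy_nonneg hΩ u
    have h2 : 0 ≤ anisotropyEnergy φ u :=
      integral_nonneg_of_ae (hu.1.mono fun x hx => hφ_nonneg _ hx)
    have h3 := neg_le_dmiEnergy hμ_int hu.1
    rw [totalEnergy]
    linarith
  have hbdd : BddBelow (totalEnergy j φ μ hΩ '' admissibleFields j Ω) := by
    refine ⟨-D, ?_⟩
    rintro _ ⟨u, hu, rfl⟩
    have := hbelow u hu
    have h0 : 0 ≤ (exchangeEnergy j u).toReal := ENNReal.toReal_nonneg
    linarith
  have hne : (totalEnergy j φ μ hΩ '' admissibleFields j Ω).Nonempty := by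
    -- A constant unit field has zero exchange energy.
    refine Set.Nonempty.image _ ⟨Lp.const 2 (volume.restrict Ω) (EuclideanSpace.single 0 1), ?_, ?_⟩
    · filter_upwards [Lp.coeFn_const (p := 2) (volume.restrict Ω)
        (EuclideanSpace.single (0 : Fin 3) (1 : ℝ))] with x hx
      rw [hx]
      simp
    · have hc := Lp.coeFn_const (p := 2) (volume.restrict Ω)
        (EuclideanSpace.single (0 : Fin 3) (1 : ℝ))
      rw [exchangeEnergy_eq_prod, lintegral_eq_zero_of_ae_eq_zero]
      · exact ENNReal.zero_lt_top
      · filter_upwards [Measure.quasiMeasurePreserving_fst.ae hc,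
          Measure.quasiMeasurePreserving_snd.ae hc] with p h1 h2
        rw [h1, h2]
        simp
  obtain ⟨e, -, he, hemem⟩ := exists_seq_tendsto_sInf hne hbdd
  choose m hmA hme using hemem
  set I := sInf (totalEnergy j φ μ hΩ '' admissibleFields j Ω)
  obtain ⟨B, hB⟩ := he.bddAbove_range
  have hC : ∀ n, exchangeEnergy j (m n) ≤ ENNReal.ofReal (B + D) := by
    intro n
    rw [ENNReal.le_ofReal_iff_toReal_le (hmA n).2.ne]
    · have h1 := hbelow _ (hmA n)
      have h2 := hB (Set.mem_range_self n)
      rw [← hme] at h2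
      linarith
    · have h1 := hbelow _ (hmA n)
      have h2 := hB (Set.mem_range_self n)
      rw [← hme] at h2
      have h0 : 0 ≤ (exchangeEnergy j (m n)).toReal := ENNReal.toReal_nonneg
      linarith
  obtain ⟨a, s, hs, ha, hlim⟩ := exists_subseq_tendsto_of_exchangeEnergy_le hΩ hj hJ3
    (fun n => (hmA n).1.mono fun x hx => mem_sphere_zero_iff_norm.1 hx) hC
  obtain ⟨t, ht, hae⟩ := exists_subseq_ae_tendsto hlim
  have hasph : ∀ᵐ x ∂volume.restrict Ω, a x ∈ sphere (0 : E3) 1 :=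
    ha.mono fun x hx => mem_sphere_zero_iff_norm.2 hx
  let r : ℕ → ℕ := fun n => s (t n)
  have hmr : ∀ n, ∀ᵐ x ∂volume.restrict Ω, m (r n) x ∈ sphere (0 : E3) 1 := fun n => (hmA _).1
  have hE : Tendsto (fun n => totalEnergy j φ μ hΩ (m (r n))) atTop (𝓝 I) := by
    simp only [hme]
    exact he.comp (hs.tendsto_atTop.comp ht.tendsto_atTop)
  have hW := ((continuous_magnetostaticEnergy hΩ).tendsto a).comp (hlim.comp ht.tendsto_atTop)
  have hA := tendsto_anisotropyEnergy hφ_lip hae hmr hasph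
  have hDM := tendsto_dmiEnergy hμ_int hae hmr
  -- The total energy and the other three terms converge, hence so do the exchange energies; Fatou
  -- bounds that of `a` by their limit.
  have hJ : Tendsto (fun n => (exchangeEnergy j (m (r n))).toReal) atTop
      (𝓝 (I - magnetostaticEnergy hΩ a - anisotropyEnergy φ a - dmiEnergy μ a)) := by
    refine (((hE.sub hW).sub hA).sub hDM).congr fun n => ?_
    simp only [totalEnergy, Function.comp_apply, r]
    ring
  have hJa := exchangeEnergy_le_of_tendsto hj hae (ENNReal.tendsto_ofReal hJ)
    fun n => (ENNReal.ofReal_toReal (hmA (r n)).2.ne).ge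
  have haA : a ∈ admissibleFields j Ω := ⟨hasph, hJa.trans_lt ENNReal.ofReal_lt_top⟩
  refine ⟨a, haA, fun u hu => le_trans ?_ (csInf_le hbdd (Set.mem_image_of_mem _ hu))⟩
  have hJr := ENNReal.toReal_le_of_le_ofReal
    (ge_of_tendsto' hJ fun n => ENNReal.toReal_nonneg) hJa
  rw [totalEnergy]
  linarith
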